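/- Let $I\subseteq\mathbb{R}$ be a nonempty open interval. A function $E:I^2\to\mathbb{R}$ is called a quasideviation if (D1) $\operatorname{sign}E(x,u)=\operatorname{sign}(x-u)$ for all $x,u\in I$; (D2) for every $x\in I$ the map $u\mapsto E(x,u)$ is continuous on $I$; (D3) for all $x<y$ in $I$ the map $u\mapsto E(x,u)/E(y,u)$ is strictly decreasing on $(x,y)$. For a quasideviation $E$, $n\ge 1$ and $x_1,\dots,x_n\in I$, the quasideviation mean $\mathscr{D}_E(x_1,\dots,x_n)$ is the unique $u\in I$ with $E(x_1,u)+\dots+E(x_n,u)=0$. It is called Jensen convex if $\mathscr{D}_E\big(\frac{x+y}{2}\big)\le\frac{\mathscr{D}_E(x)+\mathscr{D}_E(y)}{2}$ for all $n\ge1$ and all $x,y\in I^n$. Theorem. Let $E:I^2\to\mathbb{R}$ be a quasideviation and $\alpha,\beta\in(0,\infty)$. Define $E_{\alpha,\beta}:I^2\to\mathbb{R}$ by $E_{\alpha,\beta}(x,u):=\alpha E(x,u)$ for $x\le u$ and $E_{\alpha,\beta}(x,u):=\beta E(x,u)$ for $x>u$. Then: 1. $E_{\alpha,\beta}$ is a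 quasideviation. 2. If $\mathscr{D}_E$ is Jensen convex and $\alpha\le\beta$, then $\mathscr{D}_{E_{\alpha,\beta}}$ is Jensen convex. 3. Suppose that $E$ is Gateaux differentiable at every point $(u,u)$ of the diagonal of $I^2$ (that is, the limit $\lim_{t\to0}\frac{E(u+tv,u+tw)-E(u,u)}{t}$ exists in $\mathbb{R}$ for every direction $(v,w)\in\mathbb{R}^2$), and that the map $u\mapsto\partial_1E(u,u)$ is continuous on $I$. Then $\mathscr{D}_{E_{\alpha,\beta}}$ is Jensen convex if and only if $\mathscr{D}_E$ is Jensen convex and $\alpha\le\beta$. -/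

import Mathlib

open Set

/-- `E : I × I → ℝ` (only the values on `I × I` matter) is a quasideviation on `I`. -/
structure IsQuasideviation (I : Set ℝ) (E : ℝ → ℝ → ℝ) : Prop where
  sign_eq : ∀ x ∈ I, ∀ u ∈ I, SignType.sign (E x u) = SignType.sign (x - u)
  continuousOn : ∀ x ∈ I, ContinuousOn (fun u => E x u) I
  strictAntiOn : ∀ x ∈ I, ∀ y ∈ I, x < y →
    StrictAntiOn (fun u => E x u / E y u) (Ioo x y)

/-- The `E`-quasideviation mean of `x₁, …, xₙ ∈ I`: the element `u` of `I` that satisfies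
`E(x₁, u) + ⋯ + E(xₙ, u) = 0`. For a quasideviation `E` and `n ≥ 1`, this `u` exists and is unique,
see `IsQuasideviation.existsUnique_sum_eq_zero` below. -/
noncomputable def qdMean (I : Set ℝ) (E : ℝ → ℝ → ℝ) (n : ℕ) (x : Fin n → ℝ) : ℝ :=
  Classical.epsilon fun u => u ∈ I ∧ ∑ i, E (x i) u = 0

/-- Jensen convexity of `M : ⋃_{n ≥ 1} Iⁿ → ℝ`. -/
def JensenConvexMean (I : Set ℝ) (M : (n : ℕ) → (Fin n → ℝ) → ℝ) : Prop :=
  ∀ n : ℕ, 1 ≤ n → ∀ x y : Fin n → ℝ, (∀ i, x i ∈ I) → (∀ i, y i ∈ I) →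
    M n (fun i => (x i + y i) / 2) ≤ (M n x + M n y) / 2

/-- `E_{α,β}(x,u) = α E(x,u)` for `x ≤ u`, and `= β E(x,u)` for `x > u`. -/
noncomputable def scaledQD (E : ℝ → ℝ → ℝ) (α β : ℝ) (x u : ℝ) : ℝ :=
  if x ≤ u then α * E x u else β * E x u

/-- Gateaux differentiability of `E` at `(x, u)`: the (two-sided) directional derivative
`lim_{t → 0} (E(x + t v, u + t w) - E(x, u)) / t` exists for every direction `(v, w)`. -/
def GateauxDifferentiableAt (E : ℝ → ℝ → ℝ) (x u : ℝ) : Prop :=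
  ∀ v w : ℝ, LineDifferentiableAt ℝ (fun p : ℝ × ℝ => E p.1 p.2) (x, u) (v, w)

/-- `∂₁E(x, u)`, the derivative of `E(·, u)` at `x`. -/
noncomputable def partialFst (E : ℝ → ℝ → ℝ) (x u : ℝ) : ℝ :=
  deriv (fun z => E z u) x

namespace IsQuasideviation

variable {I : Set ℝ} {E : ℝ → ℝ → ℝ}

theorem pos (hE : IsQuasideviation I E) {x u : ℝ} (hx : x ∈ I) (hu : u ∈ I) (h : u < x) :
    0 < E x u := by
  have := hE.sign_eq x hx u hu
  rw [sign_pos (sub_pos.2 h)] at this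
  exact sign_eq_one_iff.1 this

theorem neg (hE : IsQuasideviation I E) {x u : ℝ} (hx : x ∈ I) (hu : u ∈ I) (h : x < u) :
    E x u < 0 := by
  have := hE.sign_eq x hx u hu
  rw [sign_neg (sub_neg.2 h)] at this
  exact sign_eq_neg_one_iff.1 this

theorem diag (hE : IsQuasideviation I E) {x : ℝ} (hx : x ∈ I) : E x x = 0 := by
  have := hE.sign_eq x hx x hx
  rw [sub_self, sign_zero] at this
  exact sign_eq_zero_iff.1 this

theorem nonpos (hE : IsQuasideviation I E) {x u : ℝ} (hx : x ∈ I) (hu : u ∈ I) (h : x ≤ u) :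
    E x u ≤ 0 := by
  rcases h.eq_or_lt with rfl | h
  · exact (hE.diag hx).le
  · exact (hE.neg hx hu h).le

theorem nonneg (hE : IsQuasideviation I E) {x u : ℝ} (hx : x ∈ I) (hu : u ∈ I) (h : u ≤ x) :
    0 ≤ E x u := by
  rcases h.eq_or_lt with rfl | h
  · exact (hE.diag hx).ge
  · exact (hE.pos hx hu h).le

theorem cross_lt (hE : IsQuasideviation I E) {x y u w : ℝ} (hx : x ∈ I) (hy : y ∈ I)
    (hu : u ∈ I) (hw : w ∈ I) (hxu : x ≤ u) (huy : u < y) (huw : u < w) :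
    E x w * E y u < E x u * E y w := by
  have h1 : E x w < 0 := hE.neg hx hw (hxu.trans_lt huw)
  have h2 : 0 < E y u := hE.pos hy hu huy
  have h3 : E x u ≤ 0 := hE.nonpos hx hu hxu
  have h4 : E x w * E y u < 0 := mul_neg_of_neg_of_pos h1 h2
  rcases le_or_gt y w with h | h
  · exact h4.trans_le (mul_nonneg_of_nonpos_of_nonpos h3 (hE.nonpos hy hw h))
  · have h5 : 0 < E y w := hE.pos hy hw h
    rcases hxu.eq_or_lt with rfl | hxu
    · rw [hE.diag hx, zero_mul]; exact h4
    · have := hE.strictAntiOn x hx y hy (hxu.trans huy) ⟨hxu, huy⟩ ⟨hxu.trans huw, h⟩ huw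
      exact (div_lt_div_iff₀ h5 h2).1 this

theorem sum_neg_of_lt (hE : IsQuasideviation I E) {n : ℕ} (hn : 1 ≤ n) {x : Fin n → ℝ}
    (hx : ∀ i, x i ∈ I) {u w : ℝ} (hu : u ∈ I) (hw : w ∈ I) (huw : u < w)
    (h0 : ∑ i, E (x i) u = 0) : ∑ i, E (x i) w < 0 := by
  classical
  haveI : Nonempty (Fin n) := ⟨⟨0, hn⟩⟩
  set A := Finset.univ.filter fun i => x i ≤ u with hA
  set B := Finset.univ.filter fun i => ¬ x i ≤ u with hB
  have hs : ∀ t, ∑ i ∈ A, E (x i) t + ∑ i ∈ B, E (x i) t = ∑ i, E (x i) t := fun t =>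
    Finset.sum_filter_add_sum_filter_not _ _ _
  have mA : ∀ i ∈ A, x i ≤ u := fun i hi => (Finset.mem_filter.1 hi).2
  have mB : ∀ i ∈ B, u < x i := fun i hi => not_le.1 (Finset.mem_filter.1 hi).2
  rcases B.eq_empty_or_nonempty with hBe | hBn
  · refine Finset.sum_neg (fun i _ => ?_) Finset.univ_nonempty
    refine hE.neg (hx i) hw (lt_of_le_of_lt ?_ huw)
    by_contra hi
    have : i ∈ B := Finset.mem_filter.2 ⟨Finset.mem_univ i, hi⟩
    simp [hBe] at this
  have hQ : 0 < ∑ i ∈ B, E (x i) u :=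
    Finset.sum_pos (fun i hi => hE.pos (hx i) hu (mB i hi)) hBn
  have hP : ∑ i ∈ A, E (x i) u < 0 := by linarith [hs u]
  have hAn : A.Nonempty := by
    rw [Finset.nonempty_iff_ne_empty]
    intro h
    simp [h] at hP
  have key : (∑ i ∈ A, E (x i) w) * (∑ j ∈ B, E (x j) u) <
      (∑ i ∈ A, E (x i) u) * ∑ j ∈ B, E (x j) w := by
    rw [Finset.sum_mul_sum, Finset.sum_mul_sum]
    refine Finset.sum_lt_sum_of_nonempty hAn fun i hi => ?_
    refine Finset.sum_lt_sum_of_nonempty hBn fun j hj => ?_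
    exact hE.cross_lt (hx i) (hx j) hu hw (mA i hi) (mB j hj) huw
  have e : ∑ i ∈ B, E (x i) u = -∑ i ∈ A, E (x i) u := by linarith [hs u]
  rw [e] at key
  rw [← hs w]
  nlinarith

/-- The quasideviation mean is well defined. -/
theorem existsUnique_sum_eq_zero (hE : IsQuasideviation I E) (hI : I.OrdConnected) {n : ℕ}
    (hn : 1 ≤ n) {x : Fin n → ℝ} (hx : ∀ i, x i ∈ I) :
    ∃! u, u ∈ I ∧ ∑ i, E (x i) u = 0 := by
  haveI : Nonempty (Fin n) := ⟨⟨0, hn⟩⟩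
  obtain ⟨a, ha⟩ := Finite.exists_min x
  obtain ⟨b, hb⟩ := Finite.exists_max x
  have hsub : Icc (x a) (x b) ⊆ I := hI.out (hx a) (hx b)
  have hc : ContinuousOn (fun u => ∑ i, E (x i) u) (Icc (x a) (x b)) :=
    continuousOn_finset_sum _ fun i _ => (hE.continuousOn (x i) (hx i)).mono hsub
  obtain ⟨u, hu, h0⟩ := intermediate_value_Icc' (ha b) hc
    ⟨Finset.sum_nonpos fun i _ => hE.nonpos (hx i) (hx b) (hb i),
      Finset.sum_nonneg fun i _ => hE.nonneg (hx i) (hx a) (ha i)⟩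
  refine ⟨u, ⟨hsub hu, h0⟩, fun w hw => ?_⟩
  rcases lt_trichotomy w u with h | h | h
  · exact absurd h0 (hE.sum_neg_of_lt hn hx hw.1 (hsub hu) h hw.2).ne
  · exact h
  · exact absurd hw.2 (hE.sum_neg_of_lt hn hx (hsub hu) hw.1 h h0).ne

theorem qdMean_eq_iff (hE : IsQuasideviation I E) (hI : I.OrdConnected) {n : ℕ}
    (hn : 1 ≤ n) {x : Fin n → ℝ} (hx : ∀ i, x i ∈ I) {u : ℝ} :
    qdMean I E n x = u ↔ u ∈ I ∧ ∑ i, E (x i) u = 0 := by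
  have h := hE.existsUnique_sum_eq_zero hI hn hx
  have hs : qdMean I E n x ∈ I ∧ ∑ i, E (x i) (qdMean I E n x) = 0 :=
    Classical.epsilon_spec h.exists
  exact ⟨fun e => e ▸ hs, fun hu => h.unique hs hu⟩

end IsQuasideviation

/-! The core is a two-variable criterion: the mean is Jensen convex iff for all u, v there are a, b
with E((x+y)/2, (u+v)/2) ≤ a E(x,u) + b E(y,v) for all x, y. Sufficiency is summation at the two
means. Necessity is a separation argument: Jensen convexity says that ∑ E(x,u) ≤ 0 and ∑ E(y,v) ≤ 0
force the midpoint sum to be ≤ 0, for all finite families with repetitions, and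
`exists_le_mul_add_mul` turns this into multipliers, which are then seen to be positive.

If α ≤ β, then E_{α,β} = max(αE, βE), and the criterion with a, b > 0 passes to this maximum.

Conversely, let E_{α,β} have a Jensen convex mean and put c(u) = ∂₁E(u,u). One shows c > 0, and
differentiating the criterion at the diagonal forces a = c(w)/(2c(u)) and b = c(w)/(2c(v)) with w =
(u+v)/2. So E_{α,β}(x,u)/c(u) is midpoint convex on I². Comparing slopes on both sides of the
diagonal gives α ≤ β. For E itself, the factor α or β cancels if (x,u) and (y,v) lie on the same
side of the diagonal. Otherwise the segment joining them crosses it at one point, where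
differentiability provides one tangent slope that glues the two sides (`midpoint_le_of_scaled`). -/

open Filter Topology

/-! ### Separation: from natural multiplicities to linear multipliers -/

section Separation

variable {T : Type*} {A B C : T → ℝ}

/-- Real weights c are approximated by ⌊ck⌋/k. The strict inequalities survive for large k, and
clearing the denominator k leaves natural weights. -/
theorem sum_mul_nonpos_of_nat
    (H : ∀ (s : Finset T) (N : T → ℕ), ∑ t ∈ s, N t * A t ≤ 0 → ∑ t ∈ s, N t * B t ≤ 0 →
      ∑ t ∈ s, N t * C t ≤ 0)
    (s : Finset T) (c : T → ℝ) (hc : ∀ t, 0 ≤ c t)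
    (hA : ∑ t ∈ s, c t * A t < 0) (hB : ∑ t ∈ s, c t * B t < 0) :
    ∑ t ∈ s, c t * C t ≤ 0 := by
  have lim : ∀ D : T → ℝ, Tendsto (fun k : ℝ => ∑ t ∈ s, ((⌊c t * k⌋₊ : ℝ) / k) * D t) atTop
      (𝓝 (∑ t ∈ s, c t * D t)) := fun D =>
    tendsto_finsetSum _ fun t _ => (tendsto_nat_floor_mul_div_atTop (hc t)).mul_const _
  have scale : ∀ (D : T → ℝ) (k : ℝ), 0 < k → (∑ t ∈ s, ((⌊c t * k⌋₊ : ℝ) / k) * D t ≤ 0 ↔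
      ∑ t ∈ s, (⌊c t * k⌋₊ : ℝ) * D t ≤ 0) := by
    intro D k hk
    have : ∑ t ∈ s, ((⌊c t * k⌋₊ : ℝ) / k) * D t = (∑ t ∈ s, (⌊c t * k⌋₊ : ℝ) * D t) / k := by
      rw [Finset.sum_div]
      exact Finset.sum_congr rfl fun t _ => by ring
    rw [this, div_le_iff₀ hk, zero_mul]
  refine le_of_tendsto (lim C) ?_
  filter_upwards [(lim A).eventually_lt_const hA, (lim B).eventually_lt_const hB,
    eventually_gt_atTop 0] with k h1 h2 hk
  exact (scale C k hk).2 (H s _ ((scale A k hk).1 h1.le) ((scale B k hk).1 h2.le))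

/-- Adding a small weight ε at a point where A and B are both negative makes the two equalities
strict inequalities; then ε → 0. -/
theorem linearCombination_nonpos_of_nat
    (H : ∀ (s : Finset T) (N : T → ℕ), ∑ t ∈ s, N t * A t ≤ 0 → ∑ t ∈ s, N t * B t ≤ 0 →
      ∑ t ∈ s, N t * C t ≤ 0)
    (hneg : ∃ t, A t < 0 ∧ B t < 0) (c : T →₀ ℝ) (hc : ∀ t, 0 ≤ c t)
    (hA : Finsupp.linearCombination ℝ A c = 0) (hB : Finsupp.linearCombination ℝ B c = 0) :
    Finsupp.linearCombination ℝ C c ≤ 0 := by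
  obtain ⟨t₀, hA₀, hB₀⟩ := hneg
  have key : ∀ ε : ℝ, 0 < ε → Finsupp.linearCombination ℝ C c + ε * C t₀ ≤ 0 := by
    intro ε hε
    have e : ∀ D : T → ℝ, Finsupp.linearCombination ℝ D c + ε * D t₀ =
        ∑ t ∈ (c + Finsupp.single t₀ ε).support, (c + Finsupp.single t₀ ε) t * D t := by
      intro D
      rw [← smul_eq_mul ε, ← Finsupp.linearCombination_single ℝ ε t₀, ← map_add,
        Finsupp.linearCombination_apply, Finsupp.sum]
      simp only [smul_eq_mul]
    rw [e]
    refine sum_mul_nonpos_of_nat H _ _ (fun t => ?_) ?_ ?_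
    · classical
      rw [Finsupp.add_apply, Finsupp.single_apply]
      have := hc t
      split_ifs <;> linarith
    · rw [← e, hA, zero_add]; exact mul_neg_of_pos_of_neg hε hA₀
    · rw [← e, hB, zero_add]; exact mul_neg_of_pos_of_neg hε hB₀
  have lim : Tendsto (fun ε : ℝ => Finsupp.linearCombination ℝ C c + ε * C t₀) (𝓝[>] 0)
      (𝓝 (Finsupp.linearCombination ℝ C c + 0 * C t₀)) :=
    ((continuous_const.add (continuous_id.mul continuous_const)).tendsto 0).mono_left
      nhdsWithin_le_nhds
  rw [zero_mul, add_zero] at lim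
  exact le_of_tendsto lim (eventually_nhdsWithin_of_forall key)

/-- A separation theorem: if `∑ A ≤ 0` and `∑ B ≤ 0` imply `∑ C ≤ 0` for all finite families, then
`C` is dominated by a linear combination of `A` and `B`. -/
theorem exists_le_mul_add_mul
    (H : ∀ (s : Finset T) (N : T → ℕ), ∑ t ∈ s, N t * A t ≤ 0 → ∑ t ∈ s, N t * B t ≤ 0 →
      ∑ t ∈ s, N t * C t ≤ 0)
    (hneg : ∃ t, A t < 0 ∧ B t < 0)
    (hAn : ∃ t, A t < 0 ∧ B t = 0) (hAp : ∃ t, 0 < A t ∧ B t = 0)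
    (hBn : ∃ t, A t = 0 ∧ B t < 0) (hBp : ∃ t, A t = 0 ∧ 0 < B t) :
    ∃ a b : ℝ, ∀ t, C t ≤ a * A t + b * B t := by
  -- M. Riesz extension for the cone spanned by the P t: the last coordinate, as a functional on the
  -- third axis, is nonnegative on the cone by `H`. An extension nonnegative on the whole cone is
  -- (z₁, z₂, z₃) ↦ a z₁ + b z₂ + z₃, and its value at P t is the claim.
  let P : T → ℝ × ℝ × ℝ := fun t => (A t, B t, -C t)
  let K : PointedCone ℝ (ℝ × ℝ × ℝ) := Submodule.span {c : ℝ // 0 ≤ c} (range P)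
  have hP : ∀ t, P t ∈ K := fun t => Submodule.subset_span ⟨t, rfl⟩
  have hK : ∀ {r : ℝ} {z : ℝ × ℝ × ℝ}, 0 ≤ r → z ∈ K → r • z ∈ K := fun {r z} hr hz =>
    K.smul_mem hr hz
  let φ : ℝ × ℝ × ℝ →ₗ[ℝ] ℝ × ℝ :=
    (LinearMap.fst ℝ ℝ (ℝ × ℝ)).prod ((LinearMap.fst ℝ ℝ ℝ).comp (LinearMap.snd ℝ ℝ (ℝ × ℝ)))
  let ψ : ℝ × ℝ × ℝ →ₗ[ℝ] ℝ := (LinearMap.snd ℝ ℝ ℝ).comp (LinearMap.snd ℝ ℝ (ℝ × ℝ))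
  let f : (ℝ × ℝ × ℝ) →ₗ.[ℝ] ℝ := ⟨LinearMap.ker φ, ψ.domRestrict (LinearMap.ker φ)⟩
  have hf : ∀ z : f.domain, f z = (z : ℝ × ℝ × ℝ).2.2 := fun z => rfl
  have mem_f : ∀ r : ℝ, ((0, 0, r) : ℝ × ℝ × ℝ) ∈ f.domain := fun r => by
    change _ ∈ LinearMap.ker φ
    simp [φ]
  have nonneg : ∀ z : f.domain, (z : ℝ × ℝ × ℝ) ∈ K → 0 ≤ f z := by
    rintro ⟨z, hz⟩ hzK
    rw [hf]
    change z ∈ LinearMap.ker φ at hz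
    obtain ⟨c, hc⟩ := Finsupp.mem_span_range_iff_exists_finsupp.1 hzK
    replace hc : (c.sum fun i a => a • P i) = z := hc
    let c' : T →₀ ℝ := c.mapRange Subtype.val rfl
    have e : Finsupp.linearCombination ℝ P c' = z := by
      rw [← hc, Finsupp.linearCombination_apply, Finsupp.sum_mapRange_index (by simp)]
      rfl
    have eL : ∀ L : ℝ × ℝ × ℝ →ₗ[ℝ] ℝ, Finsupp.linearCombination ℝ (fun t => L (P t)) c' = L z := by
      intro L
      rw [← e, Finsupp.apply_linearCombination]
      rfl
    have hz' : z.1 = 0 ∧ z.2.1 = 0 := by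
      simpa [φ, Prod.ext_iff] using hz
    have h := linearCombination_nonpos_of_nat H hneg c' (fun t => (c t).2)
      ((eL (LinearMap.fst ℝ ℝ (ℝ × ℝ))).trans hz'.1)
      ((eL ((LinearMap.fst ℝ ℝ ℝ).comp (LinearMap.snd ℝ ℝ (ℝ × ℝ)))).trans hz'.2)
    have h2 := eL (-ψ)
    have h3 : (fun t => (-ψ) (P t)) = C := by ext t; simp [ψ, P]
    rw [h3] at h2
    rw [h2] at h
    simpa [ψ] using h
  -- The four sign hypotheses let nonnegative multiples of two generators attain any prescribed
  -- first two coordinates; the third is corrected within the axis.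
  have dense : ∀ y, ∃ z : f.domain, (z : ℝ × ℝ × ℝ) + y ∈ K := by
    have axis : ∀ {D : T → ℝ} {Q : T → Prop} (r : ℝ), (∃ t, D t < 0 ∧ Q t) →
        (∃ t, 0 < D t ∧ Q t) → ∃ t, ∃ s : ℝ, Q t ∧ 0 ≤ s ∧ s * D t = r := by
      rintro D Q r ⟨t, ht, hQ⟩ ⟨t', ht', hQ'⟩
      rcases le_total r 0 with hr | hr
      · exact ⟨t, r / D t, hQ, div_nonneg_of_nonpos hr ht.le, div_mul_cancel₀ _ ht.ne⟩
      · exact ⟨t', r / D t', hQ', div_nonneg hr ht'.le, div_mul_cancel₀ _ ht'.ne'⟩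
    rintro ⟨y₁, y₂, y₃⟩
    obtain ⟨t, r, hB0, hr, e1⟩ := axis y₁ hAn hAp
    obtain ⟨t', r', hA0, hr', e2⟩ := axis (D := B) (Q := fun t => A t = 0) y₂
      (by simpa only [and_comm] using hBn) (by simpa only [and_comm] using hBp)
    refine ⟨⟨_, mem_f (-(r * C t) - r' * C t' - y₃)⟩, ?_⟩
    have h := K.add_mem (hK hr (hP t)) (hK hr' (hP t'))
    have e : ((0, 0, -(r * C t) - r' * C t' - y₃) : ℝ × ℝ × ℝ) + (y₁, y₂, y₃) =
        r • P t + r' • P t' := by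
      simp only [P, Prod.smul_mk, Prod.mk_add_mk, smul_eq_mul, hB0, hA0, ← e1, ← e2]
      ext <;> simp
      ring
    rw [e]
    exact h
  obtain ⟨g, hg, hgK⟩ := riesz_extension K f nonneg dense
  have hg1 : g (0, 0, 1) = 1 := by
    have := hg ⟨_, mem_f 1⟩
    rwa [hf] at this
  refine ⟨g (1, 0, 0), g (0, 1, 0), fun t => ?_⟩
  have h := hgK _ (hP t)
  have e : P t = A t • ((1, 0, 0) : ℝ × ℝ × ℝ) + B t • ((0, 1, 0) : ℝ × ℝ × ℝ) +
      (-C t) • ((0, 0, 1) : ℝ × ℝ × ℝ) := by simp [P]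
  rw [e, map_add, map_add, map_smul, map_smul, map_smul, hg1] at h
  simp only [smul_eq_mul] at h
  linarith

end Separation

/-! ### The two-variable criterion for Jensen convexity -/

namespace IsQuasideviation

variable {I : Set ℝ} {E : ℝ → ℝ → ℝ}

theorem qdMean_spec (hE : IsQuasideviation I E) (hI : I.OrdConnected) {n : ℕ} (hn : 1 ≤ n)
    {x : Fin n → ℝ} (hx : ∀ i, x i ∈ I) :
    qdMean I E n x ∈ I ∧ ∑ i, E (x i) (qdMean I E n x) = 0 :=
  (hE.qdMean_eq_iff hI hn hx).1 rfl

theorem qdMean_le_iff (hE : IsQuasideviation I E) (hI : I.OrdConnected) {n : ℕ} (hn : 1 ≤ n)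
    {x : Fin n → ℝ} (hx : ∀ i, x i ∈ I) {u : ℝ} (hu : u ∈ I) :
    qdMean I E n x ≤ u ↔ ∑ i, E (x i) u ≤ 0 := by
  obtain ⟨hm, h0⟩ := hE.qdMean_spec hI hn hx
  constructor
  · intro h
    rcases h.eq_or_lt with h | h
    · rw [← h, h0]
    · exact (hE.sum_neg_of_lt hn hx hm hu h h0).le
  · intro h
    have : Nonempty (Fin n) := ⟨⟨0, hn⟩⟩
    obtain ⟨a, ha⟩ := Finite.exists_min x
    rcases lt_or_ge u (x a) with hlt | hle
    · exact absurd h (not_le.2 (Finset.sum_pos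
        (fun i _ => hE.pos (hx i) hu (hlt.trans_le (ha i))) Finset.univ_nonempty))
    · have hsub : Icc (x a) u ⊆ I := hI.out (hx a) hu
      have hc : ContinuousOn (fun w => ∑ i, E (x i) w) (Icc (x a) u) :=
        continuousOn_finsetSum _ fun i _ => (hE.continuousOn (x i) (hx i)).mono hsub
      obtain ⟨w, hw, hw0⟩ := intermediate_value_Icc' hle hc
        ⟨h, Finset.sum_nonneg fun i _ => hE.nonneg (hx i) (hx a) (ha i)⟩
      rw [(hE.qdMean_eq_iff hI hn hx).2 ⟨hsub hw, hw0⟩]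
      exact hw.2

theorem midpoint_mem (hI : I.OrdConnected) {x y : ℝ} (hx : x ∈ I) (hy : y ∈ I) :
    (x + y) / 2 ∈ I := by
  have h := hI.convex hx hy (show (0 : ℝ) ≤ 1 / 2 by norm_num) (show (0 : ℝ) ≤ 1 / 2 by norm_num)
    (by norm_num)
  have e : (1 / 2 : ℝ) • x + (1 / 2 : ℝ) • y = (x + y) / 2 := by
    simp only [smul_eq_mul]; ring
  rwa [e] at h

theorem sum_midpoint_nonpos (hE : IsQuasideviation I E) (hI : I.OrdConnected)
    (hJ : JensenConvexMean I (qdMean I E)) {ι : Type*} [Fintype ι] {x y : ι → ℝ}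
    (hx : ∀ i, x i ∈ I) (hy : ∀ i, y i ∈ I) {u v : ℝ} (hu : u ∈ I) (hv : v ∈ I)
    (hxu : ∑ i, E (x i) u ≤ 0) (hyv : ∑ i, E (y i) v ≤ 0) :
    ∑ i, E ((x i + y i) / 2) ((u + v) / 2) ≤ 0 := by
  rcases isEmpty_or_nonempty ι with h | h
  · simp
  have hn : 1 ≤ Fintype.card ι := Fintype.card_pos
  let σ := (Fintype.equivFin ι).symm
  have reindex : ∀ f : ι → ℝ, ∑ j, f (σ j) = ∑ i, f i := fun f => Equiv.sum_comp σ f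
  have h1 := (hE.qdMean_le_iff hI hn (fun j => hx (σ j)) hu).2
    ((reindex fun i => E (x i) u).trans_le hxu)
  have h2 := (hE.qdMean_le_iff hI hn (fun j => hy (σ j)) hv).2
    ((reindex fun i => E (y i) v).trans_le hyv)
  have h3 := hJ _ hn (fun j => x (σ j)) (fun j => y (σ j)) (fun j => hx _) (fun j => hy _)
  rw [← reindex fun i => E ((x i + y i) / 2) ((u + v) / 2)]
  exact (hE.qdMean_le_iff hI hn (fun j => midpoint_mem hI (hx (σ j)) (hy (σ j)))
    (midpoint_mem hI hu hv)).1 (by linarith)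

/-- Repeating each t exactly N t times turns weights into tuples, the form that the separation
theorem needs. -/
theorem sum_mul_midpoint_nonpos (hE : IsQuasideviation I E) (hI : I.OrdConnected)
    (hJ : JensenConvexMean I (qdMean I E)) {T : Type*} (s : Finset T) (N : T → ℕ) {x y : T → ℝ}
    (hx : ∀ t, x t ∈ I) (hy : ∀ t, y t ∈ I) {u v : ℝ} (hu : u ∈ I) (hv : v ∈ I)
    (hxu : ∑ t ∈ s, N t * E (x t) u ≤ 0) (hyv : ∑ t ∈ s, N t * E (y t) v ≤ 0) :
    ∑ t ∈ s, N t * E ((x t + y t) / 2) ((u + v) / 2) ≤ 0 := by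
  have e : ∀ f : T → ℝ, ∑ p : (t : s) × Fin (N t), f p.1 = ∑ t ∈ s, N t * f t := by
    intro f
    rw [Fintype.sum_sigma, ← Finset.sum_coe_sort s fun t => N t * f t]
    simp
  rw [← e fun t => E (x t) u] at hxu
  rw [← e fun t => E (y t) v] at hyv
  rw [← e fun t => E ((x t + y t) / 2) ((u + v) / 2)]
  exact hE.sum_midpoint_nonpos hI hJ (fun _ => hx _) (fun _ => hy _) hu hv hxu hyv

theorem exists_mem_lt (hI : IsOpen I) {u : ℝ} (hu : u ∈ I) : ∃ x ∈ I, x < u := by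
  obtain ⟨ε, hε, h⟩ := Metric.isOpen_iff.1 hI u hu
  refine ⟨u - ε / 2, h ?_, by linarith⟩
  rw [Metric.mem_ball, Real.dist_eq, abs_of_neg] <;> linarith

theorem exists_mem_gt (hI : IsOpen I) {u : ℝ} (hu : u ∈ I) : ∃ x ∈ I, u < x := by
  obtain ⟨ε, hε, h⟩ := Metric.isOpen_iff.1 hI u hu
  refine ⟨u + ε / 2, h ?_, by linarith⟩
  rw [Metric.mem_ball, Real.dist_eq, abs_of_pos] <;> linarith

/-- The two-variable inequality that characterizes Jensen convexity: necessity. -/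
theorem exists_coeff_of_jensenConvexMean (hE : IsQuasideviation I E) (hIo : IsOpen I)
    (hI : I.OrdConnected) (hJ : JensenConvexMean I (qdMean I E)) {u v : ℝ} (hu : u ∈ I)
    (hv : v ∈ I) :
    ∃ a b : ℝ, 0 < a ∧ 0 < b ∧ ∀ x ∈ I, ∀ y ∈ I,
      E ((x + y) / 2) ((u + v) / 2) ≤ a * E x u + b * E y v := by
  obtain ⟨u₁, hu₁, hu₁u⟩ := exists_mem_lt hIo hu
  obtain ⟨u₂, hu₂, huu₂⟩ := exists_mem_gt hIo hu
  obtain ⟨v₁, hv₁, hv₁v⟩ := exists_mem_lt hIo hv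
  obtain ⟨v₂, hv₂, hvv₂⟩ := exists_mem_gt hIo hv
  obtain ⟨a, b, hab⟩ := exists_le_mul_add_mul (T := I × I) (A := fun t => E t.1 u)
    (B := fun t => E t.2 v) (C := fun t => E (((t.1 : ℝ) + t.2) / 2) ((u + v) / 2))
    (fun s N => hE.sum_mul_midpoint_nonpos hI hJ s N (fun t => t.1.2) (fun t => t.2.2) hu hv)
    ⟨(⟨u₁, hu₁⟩, ⟨v₁, hv₁⟩), hE.neg hu₁ hu hu₁u, hE.neg hv₁ hv hv₁v⟩
    ⟨(⟨u₁, hu₁⟩, ⟨v, hv⟩), hE.neg hu₁ hu hu₁u, hE.diag hv⟩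
    ⟨(⟨u₂, hu₂⟩, ⟨v, hv⟩), hE.pos hu₂ hu huu₂, hE.diag hv⟩
    ⟨(⟨u, hu⟩, ⟨v₁, hv₁⟩), hE.diag hu, hE.neg hv₁ hv hv₁v⟩
    ⟨(⟨u, hu⟩, ⟨v₂, hv₂⟩), hE.diag hu, hE.pos hv₂ hv hvv₂⟩
  have key : ∀ x ∈ I, ∀ y ∈ I, E ((x + y) / 2) ((u + v) / 2) ≤ a * E x u + b * E y v :=
    fun x hx y hy => hab (⟨x, hx⟩, ⟨y, hy⟩)
  -- Positivity comes from putting one pair on the diagonal and the other above it, so that the left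
  -- side is positive.
  refine ⟨a, b, ?_, ?_, key⟩
  · have h1 := key u₂ hu₂ v hv
    have h2 := hE.pos (midpoint_mem hI hu₂ hv) (midpoint_mem hI hu hv) (by linarith)
    rw [hE.diag hv, mul_zero, add_zero] at h1
    exact pos_of_mul_pos_left (h2.trans_le h1) (hE.pos hu₂ hu huu₂).le
  · have h1 := key u hu v₂ hv₂
    have h2 := hE.pos (midpoint_mem hI hu hv₂) (midpoint_mem hI hu hv) (by linarith)
    rw [hE.diag hu, mul_zero, zero_add] at h1
    exact pos_of_mul_pos_left (h2.trans_le h1) (hE.pos hv₂ hv hvv₂).le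

/-- The two-variable inequality that characterizes Jensen convexity: sufficiency. -/
theorem jensenConvexMean_of_coeff (hE : IsQuasideviation I E) (hI : I.OrdConnected)
    (h : ∀ u ∈ I, ∀ v ∈ I, ∃ a b : ℝ, ∀ x ∈ I, ∀ y ∈ I,
      E ((x + y) / 2) ((u + v) / 2) ≤ a * E x u + b * E y v) :
    JensenConvexMean I (qdMean I E) := by
  intro n hn x y hx hy
  obtain ⟨hu, hxu⟩ := hE.qdMean_spec hI hn hx
  obtain ⟨hv, hyv⟩ := hE.qdMean_spec hI hn hy
  obtain ⟨a, b, hab⟩ := h _ hu _ hv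
  rw [hE.qdMean_le_iff hI hn (fun i => midpoint_mem hI (hx i) (hy i)) (midpoint_mem hI hu hv)]
  refine (Finset.sum_le_sum fun i _ => hab (x i) (hx i) (y i) (hy i)).trans ?_
  rw [Finset.sum_add_distrib, ← Finset.mul_sum, ← Finset.mul_sum, hxu, hyv]
  simp

/-! ### Scaled quasideviations; the implication for α ≤ β -/

theorem scaledQD_of_le {E : ℝ → ℝ → ℝ} {α β x u : ℝ} (h : x ≤ u) :
    scaledQD E α β x u = α * E x u := if_pos h

theorem scaledQD_of_ge (hE : IsQuasideviation I E) {α β x u : ℝ} (hx : x ∈ I) (h : u ≤ x) :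
    scaledQD E α β x u = β * E x u := by
  rcases h.eq_or_lt with rfl | h
  · rw [scaledQD_of_le le_rfl, hE.diag hx, mul_zero, mul_zero]
  · exact if_neg (not_le.2 h)

theorem scaledQD_eq_min_max (hE : IsQuasideviation I E) {α β x u : ℝ} (hx : x ∈ I) (hu : u ∈ I) :
    scaledQD E α β x u = α * min (E x u) 0 + β * max (E x u) 0 := by
  rcases le_total x u with h | h
  · rw [scaledQD_of_le h, min_eq_left (hE.nonpos hx hu h), max_eq_right (hE.nonpos hx hu h)]
    ring
  · rw [hE.scaledQD_of_ge hx h, min_eq_right (hE.nonneg hx hu h), max_eq_left (hE.nonneg hx hu h)]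
    ring

theorem scaledQD_eq_max (hE : IsQuasideviation I E) {α β x u : ℝ} (hαβ : α ≤ β) (hx : x ∈ I)
    (hu : u ∈ I) : scaledQD E α β x u = max (α * E x u) (β * E x u) := by
  rcases le_total x u with h | h
  · rw [scaledQD_of_le h, max_eq_left (mul_le_mul_of_nonpos_right hαβ (hE.nonpos hx hu h))]
  · rw [hE.scaledQD_of_ge hx h,
      max_eq_right (mul_le_mul_of_nonneg_right hαβ (hE.nonneg hx hu h))]

theorem isQuasideviation_scaledQD (hE : IsQuasideviation I E) {α β : ℝ} (hα : 0 < α)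
    (hβ : 0 < β) : IsQuasideviation I (scaledQD E α β) where
  sign_eq x hx u hu := by
    rw [← hE.sign_eq x hx u hu]
    rcases le_total x u with h | h
    · rw [scaledQD_of_le h, sign_mul, sign_pos hα, one_mul]
    · rw [hE.scaledQD_of_ge hx h, sign_mul, sign_pos hβ, one_mul]
  continuousOn x hx := by
    have hc := hE.continuousOn x hx
    refine ContinuousOn.congr (f := fun u => α * min (E x u) 0 + β * max (E x u) 0) ?_
      fun u hu => hE.scaledQD_eq_min_max hx hu
    exact (continuousOn_const.mul (hc.inf continuousOn_const)).add
      (continuousOn_const.mul (hc.sup continuousOn_const))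
  strictAntiOn x hx y hy hxy := by
    -- Between x and y the numerator always carries α and the denominator β.
    have e : ∀ u ∈ Ioo x y, scaledQD E α β x u / scaledQD E α β y u =
        α / β * (E x u / E y u) := by
      intro u hu
      rw [scaledQD_of_le hu.1.le, hE.scaledQD_of_ge hy hu.2.le, mul_div_mul_comm]
    intro u hu w hw huw
    simp only [e u hu, e w hw]
    exact mul_lt_mul_of_pos_left (hE.strictAntiOn x hx y hy hxy hu hw huw) (div_pos hα hβ)

theorem jensenConvexMean_scaledQD (hE : IsQuasideviation I E) (hIo : IsOpen I)
    (hI : I.OrdConnected) {α β : ℝ} (hα : 0 < α) (hαβ : α ≤ β)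
    (hJ : JensenConvexMean I (qdMean I E)) :
    JensenConvexMean I (qdMean I (scaledQD E α β)) := by
  have hβ := hα.trans_le hαβ
  refine (hE.isQuasideviation_scaledQD hα hβ).jensenConvexMean_of_coeff hI fun u hu v hv => ?_
  obtain ⟨a, b, ha, hb, hab⟩ := hE.exists_coeff_of_jensenConvexMean hIo hI hJ hu hv
  refine ⟨a, b, fun x hx y hy => ?_⟩
  rw [hE.scaledQD_eq_max hαβ (midpoint_mem hI hx hy) (midpoint_mem hI hu hv),
    hE.scaledQD_eq_max hαβ hx hu, hE.scaledQD_eq_max hαβ hy hv]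
  have bound : ∀ γ : ℝ, 0 < γ → γ * E x u ≤ max (α * E x u) (β * E x u) →
      γ * E y v ≤ max (α * E y v) (β * E y v) →
      γ * E ((x + y) / 2) ((u + v) / 2) ≤
        a * max (α * E x u) (β * E x u) + b * max (α * E y v) (β * E y v) := by
    intro γ hγ h1 h2
    have h3 := mul_le_mul_of_nonneg_left (hab x hx y hy) hγ.le
    have h4 := mul_le_mul_of_nonneg_left h1 ha.le
    have h5 := mul_le_mul_of_nonneg_left h2 hb.le
    linarith
  exact max_le (bound α hα (le_max_left _ _) (le_max_left _ _))
    (bound β hβ (le_max_right _ _) (le_max_right _ _))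

end IsQuasideviation

/-! ### Midpoint convex functions on a segment through 0 -/

section RealLine

/-- Asking for the bound only frequently allows it to be checked along a sequence such as z/2ⁿ. -/
theorem HasDerivAt.le_of_frequently {k : ℝ → ℝ} {d C : ℝ} (hk : HasDerivAt k d 0) (h0 : k 0 = 0)
    (h : ∃ᶠ s in 𝓝[>] (0 : ℝ), k s ≤ s * C) : d ≤ C := by
  have lim := (hasDerivAt_iff_tendsto_slope.1 hk).mono_left
    (nhdsWithin_mono (0 : ℝ) fun s (hs : 0 < s) => hs.ne')
  refine le_of_tendsto_of_frequently lim ?_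
  refine (h.and_eventually self_mem_nhdsWithin).mono fun s hs => ?_
  have hs0 : 0 < s := hs.2
  rw [slope_def_field, h0, sub_zero, sub_zero, div_le_iff₀ hs0, mul_comm]
  exact hs.1

/-- Since f vanishes at a, the difference quotient of the product is that of f times g. Hence mere
continuity of u ↦ ∂₁E(u,u) suffices later. -/
theorem HasDerivAt.mul_continuousAt_of_eq_zero {f g : ℝ → ℝ} {f' a : ℝ} (hf : HasDerivAt f f' a)
    (h0 : f a = 0) (hg : ContinuousAt g a) : HasDerivAt (fun t => f t * g t) (f' * g a) a := by
  rw [hasDerivAt_iff_tendsto_slope] at hf ⊢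
  refine (hf.mul (hg.tendsto.mono_left nhdsWithin_le_nhds)).congr fun t => ?_
  rw [slope_def_field, slope_def_field, h0]
  ring

/-- The dyadic form of Jensen's inequality for midpoint convex functions. -/
theorem midpoint_convex_dyadic {g : ℝ → ℝ} {p q : ℝ}
    (hg : ∀ s ∈ Icc p q, ∀ t ∈ Icc p q, g ((s + t) / 2) ≤ (g s + g t) / 2)
    {s t : ℝ} (hs : s ∈ Icc p q) (ht : t ∈ Icc p q) (n : ℕ) :
    ∀ k : ℕ, k ≤ 2 ^ n → g ((k / 2 ^ n : ℝ) * s + (1 - k / 2 ^ n) * t) ≤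
      (k / 2 ^ n : ℝ) * g s + (1 - k / 2 ^ n) * g t := by
  induction n with
  | zero =>
    intro k hk
    have : k = 0 ∨ k = 1 := by simp at hk; omega
    rcases this with rfl | rfl <;> simp
  | succ n ih =>
    intro k hk
    have mem : ∀ i : ℕ, i ≤ 2 ^ n → (i / 2 ^ n : ℝ) * s + (1 - i / 2 ^ n) * t ∈ Icc p q := by
      intro i hi
      have h1 : (i / 2 ^ n : ℝ) ≤ 1 := by
        rw [div_le_one (by positivity)]; exact_mod_cast hi
      have h0 : (0 : ℝ) ≤ i / 2 ^ n := by positivity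
      exact convex_Icc p q hs ht h0 (sub_nonneg.2 h1) (add_sub_cancel _ _)
    obtain ⟨i, j, hi, hj, rfl⟩ : ∃ i j : ℕ, i ≤ 2 ^ n ∧ j ≤ 2 ^ n ∧ k = i + j := by
      rw [pow_succ] at hk
      exact ⟨k / 2, k - k / 2, by omega, by omega, by omega⟩
    have h := hg _ (mem i hi) _ (mem j hj)
    have hi' := ih i hi
    have hj' := ih j hj
    have e : (((i + j : ℕ) : ℝ) / 2 ^ (n + 1)) = (i / 2 ^ n + j / 2 ^ n) / 2 := by
      push_cast
      rw [pow_succ]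
      field_simp
    rw [e]
    have e2 : ((i / 2 ^ n + j / 2 ^ n) / 2 : ℝ) * s + (1 - (i / 2 ^ n + j / 2 ^ n) / 2) * t =
        (((i / 2 ^ n : ℝ) * s + (1 - i / 2 ^ n) * t) +
          ((j / 2 ^ n : ℝ) * s + (1 - j / 2 ^ n) * t)) / 2 := by ring
    rw [e2]
    linarith

theorem exists_dyadic_between {a b : ℝ} (ha : 0 ≤ a) (hab : a < b) :
    ∃ n k : ℕ, a < (k / 2 ^ n : ℝ) ∧ (k / 2 ^ n : ℝ) < b := by
  obtain ⟨n, hn⟩ := exists_pow_lt_of_lt_one (sub_pos.2 hab) (show (1 / 2 : ℝ) < 1 by norm_num)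
  have h2 : (0 : ℝ) < 2 ^ n := by positivity
  refine ⟨n, ⌊a * 2 ^ n⌋₊ + 1, ?_, ?_⟩
  · rw [lt_div_iff₀ h2]
    exact_mod_cast Nat.lt_floor_add_one _
  · rw [div_lt_iff₀ h2]
    have := Nat.floor_le (show 0 ≤ a * 2 ^ n by positivity)
    rw [one_div, inv_pow, inv_lt_iff_one_lt_mul₀ h2] at hn
    push_cast
    linarith

theorem exists_midpoint_convex_weight {g : ℝ → ℝ} {p q : ℝ}
    (hg : ∀ s ∈ Icc p q, ∀ t ∈ Icc p q, g ((s + t) / 2) ≤ (g s + g t) / 2)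
    {a b : ℝ} (ha : 0 ≤ a) (hab : a < b) (hb : b ≤ 1) :
    ∃ r ∈ Ioo a b, ∀ s ∈ Icc p q, ∀ t ∈ Icc p q,
      g (r * s + (1 - r) * t) ≤ r * g s + (1 - r) * g t := by
  obtain ⟨n, k, h1, h2⟩ := exists_dyadic_between ha hab
  refine ⟨_, ⟨h1, h2⟩, fun s hs t ht => midpoint_convex_dyadic hg hs ht n k ?_⟩
  have := (h2.trans_le hb).le
  rw [div_le_one (by positivity)] at this
  exact_mod_cast this

/-- A midpoint convex function that is nonpositive to the left of `0` is star-shaped at `0`. -/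
theorem midpoint_convex_star_right {g : ℝ → ℝ} {p q : ℝ} (hp : p < 0) (hq : 0 < q)
    (hg : ∀ s ∈ Icc p q, ∀ t ∈ Icc p q, g ((s + t) / 2) ≤ (g s + g t) / 2)
    (hneg : ∀ t ∈ Icc p 0, g t ≤ 0) {s : ℝ} (hs : 0 ≤ s) (hs1 : s < 1) :
    g (s * q) ≤ s * g q := by
  by_contra! hlt
  -- No continuity of g is available, so s is replaced by a dyadic r slightly above it: sq = rq +
  -- (1-r)z with z ≤ 0 close to 0, where g(z) ≤ 0.
  have ev : ∀ᶠ r in 𝓝 s, r * g q < g (s * q) ∧ p < (s * q - r * q) / (1 - r) := by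
    refine ((continuous_id.mul continuous_const).tendsto s).eventually_lt_const hlt |>.and ?_
    have hc : ContinuousAt (fun r : ℝ => (s * q - r * q) / (1 - r)) s :=
      ContinuousAt.div (by fun_prop) (by fun_prop) (by linarith)
    refine hc.tendsto.eventually_const_lt ?_
    simpa using hp
  obtain ⟨δ, hδ, hball⟩ := Metric.eventually_nhds_iff.1 ev
  obtain ⟨r, ⟨hr1, hr2⟩, hr⟩ := exists_midpoint_convex_weight hg hs
    (lt_min (show s < s + δ by linarith) hs1) (min_le_right _ _)
  have hrδ := hr2.trans_le (min_le_left _ _)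
  have hr1' := hr2.trans_le (min_le_right _ _)
  obtain ⟨h1, h2⟩ := hball (y := r) (by rw [Real.dist_eq, abs_of_pos] <;> linarith)
  have hz : (s * q - r * q) / (1 - r) ≤ 0 :=
    div_nonpos_of_nonpos_of_nonneg (by nlinarith) (by linarith)
  have h := hr q ⟨by linarith, le_rfl⟩ _ ⟨h2.le, hz.trans hq.le⟩
  rw [mul_div_cancel₀ _ (by linarith), add_sub_cancel] at h
  have := mul_nonpos_of_nonneg_of_nonpos (show 0 ≤ 1 - r by linarith) (hneg _ ⟨h2.le, hz⟩)
  linarith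

theorem midpoint_convex_star_left {g : ℝ → ℝ} {p q : ℝ} (hp : p < 0) (hq : 0 < q)
    (hg : ∀ s ∈ Icc p q, ∀ t ∈ Icc p q, g ((s + t) / 2) ≤ (g s + g t) / 2)
    (hneg : ∀ t ∈ Icc p 0, g t ≤ 0) {s : ℝ} (hs : 0 < s) (hs1 : s ≤ 1) :
    g (s * p) ≤ s * g p := by
  by_contra! hlt
  -- Here r is slightly below s, which again puts the complementary point z in [p, 0].
  have ev : ∀ᶠ r in 𝓝 s, r * g p < g (s * p) :=
    ((continuous_id.mul continuous_const).tendsto s).eventually_lt_const hlt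
  obtain ⟨δ, hδ, hball⟩ := Metric.eventually_nhds_iff.1 ev
  obtain ⟨r, ⟨hr1, hr2⟩, hr⟩ := exists_midpoint_convex_weight hg (le_max_right (s - δ) 0)
    (max_lt (show s - δ < s by linarith) hs) hs1
  have hrδ := (le_max_left _ _).trans_lt hr1
  have hr0 := (le_max_right _ _).trans_lt hr1
  have h1 := hball (y := r) (by rw [Real.dist_eq, abs_of_neg] <;> linarith)
  have hr' : 0 < 1 - r := by linarith
  have hz : (s * p - r * p) / (1 - r) ≤ 0 :=
    div_nonpos_of_nonpos_of_nonneg (by nlinarith) hr'.le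
  have hz2 : p ≤ (s * p - r * p) / (1 - r) := by
    rw [le_div_iff₀ hr']; nlinarith
  have h := hr p ⟨le_rfl, by linarith⟩ _ ⟨hz2, hz.trans hq.le⟩
  rw [mul_div_cancel₀ _ hr'.ne', add_sub_cancel] at h
  have := mul_nonpos_of_nonneg_of_nonpos hr'.le (hneg _ ⟨hz2, hz⟩)
  linarith

/-- If `e` becomes midpoint convex after scaling by `α` to the left of `0` and by `β` to the right
of `0`, and is differentiable at `0`, then it satisfies the midpoint inequality across `0`. -/
theorem midpoint_le_of_scaled {e : ℝ → ℝ} {p q α β d : ℝ} (hp : p < 0) (hq : 0 < q)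
    (hα : 0 < α) (hβ : 0 < β) (h0 : e 0 = 0) (hneg : ∀ t ∈ Icc p 0, e t ≤ 0)
    (hd : HasDerivAt e d 0)
    (hg : ∀ s ∈ Icc p q, ∀ t ∈ Icc p q,
      (if (s + t) / 2 ≤ 0 then α * e ((s + t) / 2) else β * e ((s + t) / 2)) ≤
        ((if s ≤ 0 then α * e s else β * e s) + (if t ≤ 0 then α * e t else β * e t)) / 2) :
    e ((p + q) / 2) ≤ (e p + e q) / 2 := by
  set g : ℝ → ℝ := fun t => if t ≤ 0 then α * e t else β * e t with hgdef
  have gl : ∀ t, t ≤ 0 → g t = α * e t := fun t ht => if_pos ht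
  have gr : ∀ t, 0 ≤ t → g t = β * e t := by
    intro t ht
    rcases ht.eq_or_lt with rfl | ht
    · simp [hgdef, h0]
    · exact if_neg (not_le.2 ht)
  have gneg : ∀ t ∈ Icc p 0, g t ≤ 0 := fun t ht => by
    rw [gl t ht.2]; exact mul_nonpos_of_nonneg_of_nonpos hα.le (hneg t ht)
  have right : ∀ s, 0 ≤ s → s < 1 → e (s * q) ≤ s * e q := by
    intro s hs hs1
    have h := midpoint_convex_star_right (g := g) hp hq hg gneg hs hs1
    rw [gr _ (by positivity), gr _ hq.le, mul_left_comm] at h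
    exact le_of_mul_le_mul_left h hβ
  have left : ∀ s, 0 < s → s ≤ 1 → e (s * p) ≤ s * e p := by
    intro s hs hs1
    have h := midpoint_convex_star_left (g := g) hp hq hg gneg hs hs1
    rw [gl _ (by nlinarith), gl _ hp.le, mul_left_comm] at h
    exact le_of_mul_le_mul_left h hα
  have hmul : ∀ z : ℝ, HasDerivAt (fun s => e (s * z)) (d * z) 0 := by
    intro z
    have h1 : HasDerivAt (fun s : ℝ => s * z) z 0 := by
      simpa using (hasDerivAt_id (0 : ℝ)).mul_const z
    exact HasDerivAt.comp (0 : ℝ) (by simpa using hd) h1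
  have ev : ∀ᶠ s in 𝓝[>] (0 : ℝ), 0 < s ∧ s < 1 := Ioo_mem_nhdsGT one_pos
  -- Star-shapedness on each side puts the tangent at 0 below e at both endpoints, with the same
  -- slope d.
  have dq : d * q ≤ e q := (hmul q).le_of_frequently (by simpa using h0)
    (ev.mono fun s hs => right s hs.1.le hs.2).frequently
  have dp : d * p ≤ e p := (hmul p).le_of_frequently (by simpa using h0)
    (ev.mono fun s hs => left s hs.1 hs.2.le).frequently
  have hpq : p / q < 0 := div_neg_of_neg_of_pos hp hq
  have hqp : q / p < 0 := div_neg_of_pos_of_neg hq hp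
  -- For m = (p+q)/2 ≥ 0: e(m) ≤ (m/q) e(q) = (e(q) + (p/q) e(q))/2, and p/q < 0 gives (p/q) e(q) ≤
  -- pd ≤ e(p). The other case is symmetric.
  rcases le_or_gt 0 ((p + q) / 2) with hm | hm
  · have h := right ((p + q) / 2 / q) (by positivity) ((div_lt_one hq).2 (by linarith))
    rw [div_mul_cancel₀ _ hq.ne'] at h
    have h1 : p / q * e q ≤ p / q * (d * q) := mul_le_mul_of_nonpos_left dq hpq.le
    have h2 : p / q * (d * q) = d * p := by field_simp
    have h3 : (p + q) / 2 / q = (1 + p / q) / 2 := by field_simp; ring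
    rw [h3] at h
    linarith
  · have h := left ((p + q) / 2 / p) (div_pos_of_neg_of_neg hm hp)
      ((div_le_one_of_neg hp).2 (by linarith))
    rw [div_mul_cancel₀ _ hp.ne] at h
    have h1 : q / p * e p ≤ q / p * (d * p) := mul_le_mul_of_nonpos_left dp hqp.le
    have h2 : q / p * (d * p) = d * q := by field_simp [hp.ne]
    have h3 : (p + q) / 2 / p = (1 + q / p) / 2 := by field_simp [hp.ne]
    rw [h3] at h
    linarith

end RealLine

/-! ### Normalization by ∂₁E(u,u) and the converse implication -/

namespace IsQuasideviation

variable {I : Set ℝ} {E : ℝ → ℝ → ℝ} {α β : ℝ}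

theorem _root_.GateauxDifferentiableAt.hasDerivAt_partialFst {u : ℝ}
    (h : GateauxDifferentiableAt E u u) (r : ℝ) :
    HasDerivAt (fun s => E (u + r * s) u) (partialFst E u u * r) 0 := by
  have h1 : DifferentiableAt ℝ (fun t : ℝ => E (u + t) u) 0 := by
    simpa [LineDifferentiableAt] using h 1 0
  have h2 : DifferentiableAt ℝ (fun z => E z u) u := by
    have h3 : DifferentiableAt ℝ (fun z : ℝ => z - u) u := by fun_prop
    have h4 := DifferentiableAt.comp (g := fun t : ℝ => E (u + t) u) u (by simpa using h1) h3
    simpa [Function.comp_def] using h4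
  have h5 : HasDerivAt (fun s : ℝ => u + r * s) r 0 := by
    simpa using ((hasDerivAt_id (0 : ℝ)).const_mul r).const_add u
  exact HasDerivAt.comp (h₂ := fun z => E z u) (0 : ℝ) (by simpa [partialFst] using h2.hasDerivAt) h5

/-- With u = v, taking x = y on either side of u forces a + b = 1; adding the criterion for (x,u)
and (u,x) gives the bound. -/
theorem two_mul_midpoint_le (hE : IsQuasideviation I E) (hIo : IsOpen I) (hI : I.OrdConnected)
    (hJ : JensenConvexMean I (qdMean I E)) {x u : ℝ} (hx : x ∈ I) (hu : u ∈ I) :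
    2 * E ((x + u) / 2) u ≤ E x u := by
  obtain ⟨a, b, -, -, hab⟩ := hE.exists_coeff_of_jensenConvexMean hIo hI hJ hu hu
  have e : (u + u) / 2 = u := by ring
  have hsum : a + b = 1 := by
    obtain ⟨u₁, hu₁, hu₁u⟩ := exists_mem_lt hIo hu
    obtain ⟨u₂, hu₂, huu₂⟩ := exists_mem_gt hIo hu
    have h1 := hab u₁ hu₁ u₁ hu₁
    have h2 := hab u₂ hu₂ u₂ hu₂
    rw [add_self_div_two, add_self_div_two, ← add_mul] at h1 h2
    have h3 := hE.neg hu₁ hu hu₁u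
    have h4 := hE.pos hu₂ hu huu₂
    nlinarith
  have h1 := hab x hx u hu
  have h2 := hab u hu x hx
  rw [e, hE.diag hu] at h1 h2
  rw [add_comm u x] at h2
  have h3 : a * E x u + b * E x u = E x u := by rw [← add_mul, hsum, one_mul]
  linarith

/-- Iterated halving towards u from some x < u gives E(u-(u-x)/2ⁿ, u) ≤ E(x,u)/2ⁿ, so the slope at u
is at least E(x,u)/(x-u) > 0. -/
theorem partialFst_pos (hE : IsQuasideviation I E) (hIo : IsOpen I) (hI : I.OrdConnected)
    (hα : 0 < α) (hβ : 0 < β) (hJ : JensenConvexMean I (qdMean I (scaledQD E α β)))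
    {u : ℝ} (hu : u ∈ I) (hG : GateauxDifferentiableAt E u u) : 0 < partialFst E u u := by
  obtain ⟨x, hx, hxu⟩ := exists_mem_lt hIo hu
  have hF := hE.isQuasideviation_scaledQD hα hβ
  have hmem : ∀ n : ℕ, u + -1 * ((u - x) / 2 ^ n) ∈ Icc x u := by
    intro n
    have h1 : (u - x) / 2 ^ n ≤ u - x :=
      div_le_self (by linarith) (one_le_pow₀ (by norm_num))
    have h2 : 0 ≤ (u - x) / 2 ^ n := div_nonneg (by linarith) (by positivity)
    constructor <;> linarith
  have hle : ∀ n : ℕ, E (u + -1 * ((u - x) / 2 ^ n)) u ≤ (u - x) / 2 ^ n * (E x u / (u - x)) := by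
    have hne : u - x ≠ 0 := by linarith
    intro n
    induction n with
    | zero => simp [mul_div_cancel₀ _ hne]
    | succ n ih =>
      have hz := hmem n
      have h := hF.two_mul_midpoint_le hIo hI hJ (hI.out hx hu hz) hu
      rw [scaledQD_of_le (by linarith [hz.2]), scaledQD_of_le hz.2, mul_left_comm] at h
      have h' := le_of_mul_le_mul_left h hα
      have e1 : (u + -1 * ((u - x) / 2 ^ n) + u) / 2 = u + -1 * ((u - x) / 2 ^ (n + 1)) := by
        rw [pow_succ]; field_simp; ring
      have e2 : (u - x) / 2 ^ n = 2 * ((u - x) / 2 ^ (n + 1)) := by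
        rw [pow_succ]; field_simp
      rw [e1] at h'
      rw [e2] at ih h'
      linarith
  have lim : Tendsto (fun n : ℕ => (u - x) / 2 ^ n) atTop (𝓝[>] 0) := by
    refine tendsto_nhdsWithin_iff.2 ⟨?_, Eventually.of_forall fun n =>
      div_pos (sub_pos.2 hxu) (by positivity)⟩
    exact tendsto_const_nhds.div_atTop (tendsto_pow_atTop_atTop_of_one_lt (by norm_num))
  have h := (hG.hasDerivAt_partialFst (-1)).le_of_frequently
    (by simpa using hE.diag hu) (lim.frequently (Eventually.of_forall hle).frequently)
  have := div_neg_of_neg_of_pos (hE.neg hx hu hxu) (sub_pos.2 hxu)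
  linarith

/-- The hypothesis is the criterion with the second pair on the diagonal. Both sides carry the same
factor α or β, so s ↦ a E(u+2s,u) - E(w+s,w) has a local minimum at 0. -/
theorem two_mul_coeff_eq (hE : IsQuasideviation I E) (hIo : IsOpen I)
    (hα : 0 < α) (hβ : 0 < β) (hG : ∀ u ∈ I, GateauxDifferentiableAt E u u) {u w a : ℝ}
    (hu : u ∈ I) (hw : w ∈ I)
    (h : ∀ s, u + 2 * s ∈ I → scaledQD E α β (w + 1 * s) w ≤ a * scaledQD E α β (u + 2 * s) u) :
    2 * a * partialFst E u u = partialFst E w w := by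
  have hd := (((hG u hu).hasDerivAt_partialFst 2).const_mul a).sub
    ((hG w hw).hasDerivAt_partialFst 1)
  have hmin : IsLocalMin ((fun s => a * E (u + 2 * s) u) - fun s => E (w + 1 * s) w) 0 := by
    have c1 : Tendsto (fun s : ℝ => u + 2 * s) (𝓝 0) (𝓝 u) := by
      have : Continuous fun s : ℝ => u + 2 * s := by fun_prop
      simpa using this.tendsto 0
    have c2 : Tendsto (fun s : ℝ => w + 1 * s) (𝓝 0) (𝓝 w) := by
      have : Continuous fun s : ℝ => w + 1 * s := by fun_prop
      simpa using this.tendsto 0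
    filter_upwards [c1.eventually (hIo.mem_nhds hu), c2.eventually (hIo.mem_nhds hw)] with s hs hs'
    have hle := h s hs
    simp only [Pi.sub_apply, mul_zero, add_zero, hE.diag hu, hE.diag hw, sub_zero]
    rw [sub_nonneg]
    rcases le_total s 0 with h0 | h0
    · rw [scaledQD_of_le (by linarith), scaledQD_of_le (by linarith), mul_left_comm] at hle
      exact le_of_mul_le_mul_left hle hα
    · rw [hE.scaledQD_of_ge hs' (by linarith), hE.scaledQD_of_ge hs (by linarith),
        mul_left_comm] at hle
      exact le_of_mul_le_mul_left hle hβ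
  have := hmin.hasDerivAt_eq_zero hd
  linarith

theorem scaledQD_div_partialFst_midpoint_le (hE : IsQuasideviation I E) (hIo : IsOpen I)
    (hI : I.OrdConnected) (hα : 0 < α) (hβ : 0 < β)
    (hJ : JensenConvexMean I (qdMean I (scaledQD E α β)))
    (hG : ∀ u ∈ I, GateauxDifferentiableAt E u u)
    {x u y v : ℝ} (hx : x ∈ I) (hu : u ∈ I) (hy : y ∈ I) (hv : v ∈ I) :
    scaledQD E α β ((x + y) / 2) ((u + v) / 2) / partialFst E ((u + v) / 2) ((u + v) / 2) ≤
      (scaledQD E α β x u / partialFst E u u + scaledQD E α β y v / partialFst E v v) / 2 := by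
  have hF := hE.isQuasideviation_scaledQD hα hβ
  obtain ⟨a, b, -, -, hab⟩ := hF.exists_coeff_of_jensenConvexMean hIo hI hJ hu hv
  have hw := midpoint_mem hI hu hv
  have ea : 2 * a * partialFst E u u = partialFst E ((u + v) / 2) ((u + v) / 2) := by
    refine hE.two_mul_coeff_eq hIo hα hβ hG hu hw fun s hs => ?_
    have h := hab _ hs v hv
    rw [hF.diag hv] at h
    convert h using 1
    · congr 1; ring
    · ring
  have eb : 2 * b * partialFst E v v = partialFst E ((u + v) / 2) ((u + v) / 2) := by
    refine hE.two_mul_coeff_eq hIo hα hβ hG hv hw fun s hs => ?_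
    have h := hab u hu _ hs
    rw [hF.diag hu] at h
    convert h using 1
    · congr 1; ring
    · ring
  have hcu := hE.partialFst_pos hIo hI hα hβ hJ hu (hG u hu)
  have hcv := hE.partialFst_pos hIo hI hα hβ hJ hv (hG v hv)
  have hcw := hE.partialFst_pos hIo hI hα hβ hJ hw (hG _ hw)
  rw [div_le_iff₀ hcw]
  refine (hab x hx y hy).trans_eq ?_
  have e1 : scaledQD E α β x u / partialFst E u u *
      partialFst E ((u + v) / 2) ((u + v) / 2) = 2 * a * scaledQD E α β x u := by
    rw [← ea]; field_simp
  have e2 : scaledQD E α β y v / partialFst E v v *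
      partialFst E ((u + v) / 2) ((u + v) / 2) = 2 * b * scaledQD E α β y v := by
    rw [← eb]; field_simp
  linarith

/-- The pairs (u+s,u) and (u-s,u) give 0 ≤ β E(u+s,u) + α E(u-s,u), whose derivative at 0 is (β-α)
∂₁E(u,u). -/
theorem le_of_jensenConvexMean_scaledQD (hE : IsQuasideviation I E) (hIo : IsOpen I)
    (hI : I.OrdConnected) (hα : 0 < α) (hβ : 0 < β)
    (hJ : JensenConvexMean I (qdMean I (scaledQD E α β)))
    (hG : ∀ u ∈ I, GateauxDifferentiableAt E u u) {u : ℝ} (hu : u ∈ I) : α ≤ β := by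
  have hc := hE.partialFst_pos hIo hI hα hβ hJ hu (hG u hu)
  have hF := hE.isQuasideviation_scaledQD hα hβ
  have hd := ((((hG u hu).hasDerivAt_partialFst 1).const_mul β).add
    (((hG u hu).hasDerivAt_partialFst (-1)).const_mul α)).neg
  have hmem : ∀ r : ℝ, ∀ᶠ s in 𝓝[>] (0 : ℝ), u + r * s ∈ I := by
    intro r
    have hcont : Continuous fun s : ℝ => u + r * s := by fun_prop
    exact nhdsWithin_le_nhds (hcont.tendsto 0 |>.eventually (hIo.mem_nhds (by simpa using hu)))
  have h := hd.le_of_frequently (C := 0) (by simp [hE.diag hu]) (Eventually.frequently ?_)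
  · have : 0 ≤ (β - α) * partialFst E u u := by linarith
    exact sub_nonneg.1 (nonneg_of_mul_nonneg_left this hc)
  · filter_upwards [hmem 1, hmem (-1), self_mem_nhdsWithin] with s h1 h2 h0
    have hs : 0 < s := h0
    have h := hE.scaledQD_div_partialFst_midpoint_le hIo hI hα hβ hJ hG h1 hu h2 hu
    have e : (u + 1 * s + (u + -1 * s)) / 2 = u := by ring
    rw [add_self_div_two, e, hF.diag hu, zero_div, ← add_div,
      hE.scaledQD_of_ge h1 (by linarith), scaledQD_of_le (by linarith), div_div] at h
    have h3 := (le_div_iff₀ (by positivity)).1 h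
    rw [zero_mul] at h3
    change -(β * E (u + 1 * s) u + α * E (u + -1 * s) u) ≤ s * 0
    linarith

theorem div_partialFst_midpoint_le_of_crossing (hE : IsQuasideviation I E) (hIo : IsOpen I)
    (hI : I.OrdConnected) (hα : 0 < α) (hβ : 0 < β)
    (hJ : JensenConvexMean I (qdMean I (scaledQD E α β)))
    (hG : ∀ u ∈ I, GateauxDifferentiableAt E u u)
    (hc : ContinuousOn (fun u => partialFst E u u) I)
    {x u y v : ℝ} (hx : x ∈ I) (hu : u ∈ I) (hy : y ∈ I) (hv : v ∈ I) (hux : u < x) (hyv : y < v) :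
    E ((x + y) / 2) ((u + v) / 2) / partialFst E ((u + v) / 2) ((u + v) / 2) ≤
      (E x u / partialFst E u u + E y v / partialFst E v v) / 2 := by
  have hpos : 0 < (v - y) + (x - u) := by linarith
  -- The line through (y,v) and (x,u) is parametrized so that t = p and t = q are these points and t
  -- = 0 is its diagonal point (d,d).
  set p := -(v - y) / ((v - y) + (x - u)) with hp
  set q := (x - u) / ((v - y) + (x - u)) with hq
  have hp0 : p < 0 := div_neg_of_neg_of_pos (by linarith) hpos
  have hq0 : 0 < q := div_pos (by linarith) hpos
  have hqp : q - p = 1 := by rw [hp, hq]; field_simp; ring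
  set d := v - p * (u - v) with hd
  have hd' : d = y - p * (x - y) := by
    have : p * ((v - y) + (x - u)) = -(v - y) := div_mul_cancel₀ _ hpos.ne'
    linarith
  have mem : ∀ {a b : ℝ}, a ∈ I → b ∈ I → ∀ t ∈ Icc p q, a + (t - p) * (b - a) ∈ I := by
    intro a b ha hb t ht
    have h1 : t - p ≤ 1 := by linarith [ht.2]
    exact hI.convex.add_smul_sub_mem ha hb ⟨sub_nonneg.2 ht.1, h1⟩
  have memX : ∀ t ∈ Icc p q, d + t * (x - y) ∈ I := fun t ht => by
    have := mem hy hx t ht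
    rwa [show y + (t - p) * (x - y) = d + t * (x - y) by rw [hd']; ring] at this
  have memU : ∀ t ∈ Icc p q, d + t * (u - v) ∈ I := fun t ht => by
    have := mem hv hu t ht
    rwa [show v + (t - p) * (u - v) = d + t * (u - v) by rw [hd]; ring] at this
  have hdI : d ∈ I := by simpa using memX 0 ⟨hp0.le, hq0.le⟩
  have exq : d + q * (x - y) = x := by
    rw [hd', show q = p + 1 by linarith]; ring
  have euq : d + q * (u - v) = u := by
    rw [hd, show q = p + 1 by linarith]; ring
  have exp : d + p * (x - y) = y := by rw [hd']; ring
  have eup : d + p * (u - v) = v := by rw [hd]; ring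
  have exm : d + (p + q) / 2 * (x - y) = (x + y) / 2 := by linarith
  have eum : d + (p + q) / 2 * (u - v) = (u + v) / 2 := by linarith
  set e : ℝ → ℝ := fun t => E (d + t * (x - y)) (d + t * (u - v)) *
    (partialFst E (d + t * (u - v)) (d + t * (u - v)))⁻¹ with he
  have cpos : ∀ t ∈ Icc p q, 0 < partialFst E (d + t * (u - v)) (d + t * (u - v)) :=
    fun t ht => hE.partialFst_pos hIo hI hα hβ hJ (memU t ht) (hG _ (memU t ht))
  have order : ∀ t, t ≤ 0 ↔ d + t * (x - y) ≤ d + t * (u - v) := by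
    intro t
    constructor
    · intro ht; nlinarith
    · intro h
      by_contra! ht
      nlinarith
  have scaled : ∀ t, (if t ≤ 0 then α * e t else β * e t) =
      scaledQD E α β (d + t * (x - y)) (d + t * (u - v)) /
        partialFst E (d + t * (u - v)) (d + t * (u - v)) := by
    intro t
    simp only [scaledQD, ← order, he]
    split_ifs <;> rw [div_eq_mul_inv, mul_assoc]
  have h0 : e 0 = 0 := by simp [he, hE.diag hdI]
  have hneg : ∀ t ∈ Icc p 0, e t ≤ 0 := by
    intro t ht
    have ht' : t ∈ Icc p q := ⟨ht.1, ht.2.trans hq0.le⟩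
    exact mul_nonpos_of_nonpos_of_nonneg
      (hE.nonpos (memX t ht') (memU t ht') ((order t).1 ht.2)) (inv_pos.2 (cpos t ht')).le
  have hderiv : ∃ d', HasDerivAt e d' 0 := by
    have hf : DifferentiableAt ℝ (fun t : ℝ => E (d + t * (x - y)) (d + t * (u - v))) 0 := by
      simpa [LineDifferentiableAt] using hG d hdI (x - y) (u - v)
    have hcd : ContinuousAt (fun w => partialFst E w w) d := hc.continuousAt (hIo.mem_nhds hdI)
    have hline : ContinuousAt (fun t : ℝ => d + t * (u - v)) 0 := by fun_prop
    have hcl : ContinuousAt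
        (fun t : ℝ => partialFst E (d + t * (u - v)) (d + t * (u - v))) 0 :=
      ContinuousAt.comp (g := fun w => partialFst E w w) (by simpa using hcd) hline
    exact ⟨_, hf.hasDerivAt.mul_continuousAt_of_eq_zero (by simpa using hE.diag hdI)
      (hcl.inv₀ (cpos 0 ⟨hp0.le, hq0.le⟩).ne')⟩
  obtain ⟨d', hd''⟩ := hderiv
  have key := midpoint_le_of_scaled hp0 hq0 hα hβ h0 hneg hd'' fun s hs t ht => by
    rw [scaled, scaled, scaled]
    have h := hE.scaledQD_div_partialFst_midpoint_le hIo hI hα hβ hJ hG (memX s hs) (memU s hs)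
      (memX t ht) (memU t ht)
    rwa [show (d + s * (x - y) + (d + t * (x - y))) / 2 = d + (s + t) / 2 * (x - y) by ring,
      show (d + s * (u - v) + (d + t * (u - v))) / 2 = d + (s + t) / 2 * (u - v) by ring] at h
  simp only [he, exq, euq, exp, eup, exm, eum, ← div_eq_mul_inv] at key
  linarith

theorem div_partialFst_midpoint_le (hE : IsQuasideviation I E) (hIo : IsOpen I)
    (hI : I.OrdConnected) (hα : 0 < α) (hβ : 0 < β)
    (hJ : JensenConvexMean I (qdMean I (scaledQD E α β)))
    (hG : ∀ u ∈ I, GateauxDifferentiableAt E u u)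
    (hc : ContinuousOn (fun u => partialFst E u u) I)
    {x u y v : ℝ} (hx : x ∈ I) (hu : u ∈ I) (hy : y ∈ I) (hv : v ∈ I) :
    E ((x + y) / 2) ((u + v) / 2) / partialFst E ((u + v) / 2) ((u + v) / 2) ≤
      (E x u / partialFst E u u + E y v / partialFst E v v) / 2 := by
  have h := hE.scaledQD_div_partialFst_midpoint_le hIo hI hα hβ hJ hG hx hu hy hv
  have cancel : ∀ {γ r s t : ℝ}, 0 < γ → γ * r ≤ (γ * s + γ * t) / 2 → r ≤ (s + t) / 2 := by
    intro γ r s t hγ h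
    rw [← mul_add, mul_div_assoc] at h
    exact le_of_mul_le_mul_left h hγ
  rcases lt_trichotomy x u with hxu | hxu | hxu <;> rcases lt_trichotomy y v with hyv | hyv | hyv
  case inl.inr.inr =>
    have h' := hE.div_partialFst_midpoint_le_of_crossing hIo hI hα hβ hJ hG hc hy hv hx hu hyv hxu
    rw [add_comm y, add_comm v] at h'
    linarith
  case inr.inr.inl =>
    exact hE.div_partialFst_midpoint_le_of_crossing hIo hI hα hβ hJ hG hc hx hu hy hv hxu hyv
  case inl.inl | inl.inr.inl | inr.inl.inl | inr.inl.inr.inl =>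
    rw [scaledQD_of_le (by linarith), scaledQD_of_le (by linarith), scaledQD_of_le (by linarith),
      mul_div_assoc, mul_div_assoc, mul_div_assoc] at h
    exact cancel hα h
  case inr.inl.inr.inr | inr.inr.inr.inl | inr.inr.inr.inr =>
    rw [hE.scaledQD_of_ge (midpoint_mem hI hx hy) (by linarith),
      hE.scaledQD_of_ge hx (by linarith), hE.scaledQD_of_ge hy (by linarith),
      mul_div_assoc, mul_div_assoc, mul_div_assoc] at h
    exact cancel hβ h

theorem jensenConvexMean_of_scaledQD (hE : IsQuasideviation I E) (hIo : IsOpen I)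
    (hI : I.OrdConnected) (hα : 0 < α) (hβ : 0 < β)
    (hJ : JensenConvexMean I (qdMean I (scaledQD E α β)))
    (hG : ∀ u ∈ I, GateauxDifferentiableAt E u u)
    (hc : ContinuousOn (fun u => partialFst E u u) I) :
    JensenConvexMean I (qdMean I E) := by
  refine hE.jensenConvexMean_of_coeff hI fun u hu v hv => ?_
  have hw := midpoint_mem hI hu hv
  have hcw := hE.partialFst_pos hIo hI hα hβ hJ hw (hG _ hw)
  refine ⟨partialFst E ((u + v) / 2) ((u + v) / 2) / (2 * partialFst E u u),
    partialFst E ((u + v) / 2) ((u + v) / 2) / (2 * partialFst E v v), fun x hx y hy => ?_⟩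
  have h := hE.div_partialFst_midpoint_le hIo hI hα hβ hJ hG hc hx hu hy hv
  rw [div_le_iff₀ hcw] at h
  refine h.trans_eq ?_
  ring

end IsQuasideviation

theorem mainTheorem2 (I : Set ℝ) (hI_open : IsOpen I) (hI_conn : I.OrdConnected)
    (hI_ne : I.Nonempty) (E : ℝ → ℝ → ℝ) (hE : IsQuasideviation I E)
    (α β : ℝ) (hα : 0 < α) (hβ : 0 < β) :
    IsQuasideviation I (scaledQD E α β) ∧
    (JensenConvexMean I (qdMean I E) → α ≤ β →
      JensenConvexMean I (qdMean I (scaledQD E α β))) ∧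
    ((∀ u ∈ I, GateauxDifferentiableAt E u u) →
      ContinuousOn (fun u => partialFst E u u) I →
      (JensenConvexMean I (qdMean I (scaledQD E α β)) ↔
        JensenConvexMean I (qdMean I E) ∧ α ≤ β)) := by
  refine ⟨hE.isQuasideviation_scaledQD hα hβ,
    fun hJ hαβ => hE.jensenConvexMean_scaledQD hI_open hI_conn hα hαβ hJ,
    fun hG hc => ⟨fun hJ => ⟨?_, ?_⟩,
      fun h => hE.jensenConvexMean_scaledQD hI_open hI_conn hα h.2 h.1⟩⟩
  · exact hE.jensenConvexMean_of_scaledQD hI_open hI_conn hα hβ hJ hG hc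
  · obtain ⟨u, hu⟩ := hI_ne
    exact hE.le_of_jensenConvexMean_scaledQD hI_open hI_conn hα hβ hJ hG hu
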